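/- Let $V$ be a finite-dimensional complex vector space, let $T\in\mathrm{End}(V)$, and let $C(T)=\{U\in GL(V) : UT=TU\}$ be its centralizer group, acting on $V$. Fix a Jordan decomposition of $T$. For each eigenvalue $\lambda\in\mathrm{Spec}(T)$ let $i^\lambda_1<i^\lambda_2<\dots<i^\lambda_{r_\lambda}$ be the distinct sizes of the Jordan blocks of $T$ with eigenvalue $\lambda$, let $m^\lambda_{i}$ be the number of Jordan blocks of size $i$ with eigenvalue $\lambda$, and put \[ \Delta^\lambda_1=i^\lambda_1,\qquad \Delta^\lambda_k=i^\lambda_k-i^\lambda_{k-1}\quad(1<k\le r_\lambda),\qquad M^\lambda_k=\sum_{l=k}^{r_\lambda} m^\lambda_{i^\lambda_l}\quad(1\le k\le r_\lambda). \] Define the polynomial \[ f_\lambda(x)=\prod_{k=1}^{r_\lambda}\left(\sum_{i=0}^{\Delta^\lambda_k} x^{\,iM^\lambda_k}\right). \] Then for every integer $n\ge 0$ the number of $C(T)$-orbits in $V$ of dimension $n$ is finite and equals the coefficient of $x^n$ in \[ \prod_{\lambda\in\mathrm{Spec}(T)} f_\lambda(x). \] Here the dimension of an orbit is its dimension as a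 subset of the affine space $V$ in the Zariski topology (the Krull dimension of the orbit with the induced topology). -/

import Mathlib

open Polynomial

namespace CentralizerOrbits

universe u

variable {V : Type u} [AddCommGroup V] [Module ℂ V]

/-- The centralizer group `C(T)`: the invertible operators on `V` that commute with `T`. -/
def centralizerGroup (T : Module.End ℂ V) : Subgroup (V ≃ₗ[ℂ] V) where
  carrier := {U | ∀ v, U (T v) = T (U v)}
  one_mem' := fun _ => rfl
  mul_mem' := by
    intro A B hA hB v
    change A (B (T v)) = T (A (B v))
    rw [hB, hA]
  inv_mem' := by
    intro A hA v
    change A.symm (T v) = T (A.symm v)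
    rw [LinearEquiv.symm_apply_eq, hA, LinearEquiv.apply_symm_apply]

/-! ### Dimension of subsets of `V` -/

/-- The algebra of polynomial functions on `V`, generated by the linear functionals. -/
def polynomialFunctions (V : Type u) [AddCommGroup V] [Module ℂ V] : Subalgebra ℂ (V → ℂ) :=
  Algebra.adjoin ℂ (Set.range fun φ : Module.Dual ℂ V => (φ : V → ℂ))

/-- The common zero set in `V` of a set of functions. -/
def zeroLocus (S : Set (V → ℂ)) : Set V := {v | ∀ f ∈ S, f v = 0}

/-- The Zariski topology on `V`: the closed sets are the common zero sets of families of
polynomial functions. -/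
@[reducible] def zariskiTopology (V : Type u) [AddCommGroup V] [Module ℂ V] : TopologicalSpace V :=
  TopologicalSpace.ofClosed
    {Z : Set V | ∃ S : Set (V → ℂ), S ⊆ polynomialFunctions V ∧ Z = zeroLocus S}
    (by
      refine ⟨{1}, by simp [one_mem], ?_⟩
      ext v
      simp [zeroLocus])
    (by
      intro A hA
      refine ⟨{f | f ∈ polynomialFunctions V ∧ ∃ Z ∈ A, ∀ v ∈ Z, f v = 0},
        fun f hf => hf.1, ?_⟩
      ext v
      constructor
      · rintro hv f ⟨-, Z, hZ, hf⟩
        exact hf v (hv Z hZ)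
      · intro hv Z hZ
        obtain ⟨S, hS, rfl⟩ := hA hZ
        exact fun f hf => hv f ⟨hS hf, _, hZ, fun w hw => hw f hf⟩)
    (by
      rintro _ ⟨S, hS, rfl⟩ _ ⟨S', hS', rfl⟩
      refine ⟨{h | ∃ f ∈ S, ∃ g ∈ S', h = f * g}, ?_, ?_⟩
      · rintro _ ⟨f, hf, g, hg, rfl⟩
        exact mul_mem (hS hf) (hS' hg)
      · ext v
        constructor
        · rintro (hv | hv) _ ⟨f, hf, g, hg, rfl⟩
          · simp [hv f hf]
          · simp [hv g hg]
        · intro hv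
          by_contra hcon
          simp only [Set.mem_union, not_or, zeroLocus, Set.mem_ofPred_eq, not_forall] at hcon
          obtain ⟨⟨f, hf, hfv⟩, ⟨g, hg, hgv⟩⟩ := hcon
          exact mul_ne_zero hfv hgv (hv (f * g) ⟨f, hf, g, hg, rfl⟩))

/-- The dimension of a subset of `V` in the sense of algebraic geometry: the Krull dimension of
the subset with the topology induced by the Zariski topology of `V`. -/
noncomputable def algebraicDim (S : Set V) : WithBot ℕ∞ :=
  @topologicalKrullDim S (@instTopologicalSpaceSubtype V (· ∈ S) (zariskiTopology V))

/-! ### Jordan decompositions -/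

/-- A Jordan decomposition of `T`: finitely many blocks, each with an eigenvalue and a positive
size, and a basis of `V` in which `T` is block diagonal, a block with eigenvalue `μ` and size `s`
having a basis `e₀, …, e_{s-1}` with `T e_j = μ e_j + e_{j+1}` for `j + 1 < s` and
`T e_{s-1} = μ e_{s-1}`. -/
structure JordanDecomposition (T : Module.End ℂ V) where
  numBlocks : ℕ
  eigenvalue : Fin numBlocks → ℂ
  size : Fin numBlocks → ℕ
  size_pos : ∀ b, 0 < size b
  basis : Module.Basis (Σ b : Fin numBlocks, Fin (size b)) ℂ V
  map_basis : ∀ (b : Fin numBlocks) (j : Fin (size b)),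
    T (basis ⟨b, j⟩) = eigenvalue b • basis ⟨b, j⟩ +
      if h : (j : ℕ) + 1 < size b then basis ⟨b, ⟨(j : ℕ) + 1, h⟩⟩ else 0

/-- The basis `1, X - μ, …, (X - μ) ^ (e - 1)` of `ℂ[X] / (p ^ e)` for `p` an irreducible
polynomial with root `μ`. -/
theorem exists_basis_quotient (p : ℂ[X]) (hp : Irreducible p) (e : ℕ) :
    ∃ (μ : ℂ) (b : Module.Basis (Fin e) ℂ (ℂ[X] ⧸ Submodule.span ℂ[X] {p ^ e})),
      ∀ j : Fin e, (X : ℂ[X]) • b j = μ • b j +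
        if h : (j : ℕ) + 1 < e then b ⟨(j : ℕ) + 1, h⟩ else 0 := by
  obtain ⟨μ, hμ⟩ := IsAlgClosed.exists_root p (degree_pos_of_irreducible hp).ne'
  have hass : Associated (X - C μ) p :=
    (irreducible_X_sub_C μ).associated_of_dvd hp (dvd_iff_isRoot.mpr hμ)
  have hspan : Ideal.span {p ^ e} =
      (Ideal.span {(X : ℂ[X]) ^ e}).map (algEquivAevalXAddC (-μ) : ℂ[X] →+* ℂ[X]) := by
    rw [Ideal.map_span, Set.image_singleton]
    have : (algEquivAevalXAddC (-μ) : ℂ[X] →+* ℂ[X]) (X ^ e) = (X - C μ) ^ e := by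
      simp [sub_eq_add_neg]
    rw [this]
    exact (Ideal.span_singleton_eq_span_singleton.mpr (hass.pow_pow (n := e))).symm
  let φ := Ideal.quotientEquivAlg _ _ (algEquivAevalXAddC (-μ)) hspan
  let b₀ : Module.Basis (Fin e) ℂ (ℂ[X] ⧸ Ideal.span {(X : ℂ[X]) ^ e}) :=
    (AdjoinRoot.powerBasisAux' (monic_X_pow (R := ℂ) e)).reindex (finCongr (natDegree_X_pow e))
  have hb₀ : ∀ j : Fin e, b₀ j = Ideal.Quotient.mk _ ((X : ℂ[X]) ^ (j : ℕ)) := by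
    intro j
    have := (AdjoinRoot.powerBasis' (monic_X_pow (R := ℂ) e)).basis_eq_pow
      ((finCongr (natDegree_X_pow e)).symm j)
    have h2 : b₀ j = (AdjoinRoot.powerBasis' (monic_X_pow (R := ℂ) e)).basis
        ((finCongr (natDegree_X_pow e)).symm j) := by
      exact Module.Basis.reindex_apply (AdjoinRoot.powerBasisAux' (monic_X_pow (R := ℂ) e)) _ _
    rw [h2]
    refine this.trans ?_
    rw [map_pow]
    rfl
  let b : Module.Basis (Fin e) ℂ (ℂ[X] ⧸ Submodule.span ℂ[X] {p ^ e}) := b₀.map φ.toLinearEquiv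
  have hb : ∀ j : Fin e, b j = Ideal.Quotient.mk _ ((X - C μ) ^ (j : ℕ)) := by
    intro j
    change φ (b₀ j) = _
    rw [hb₀]
    change Ideal.Quotient.mk _ (algEquivAevalXAddC (-μ) (X ^ (j : ℕ))) = _
    congr 1
    simp [sub_eq_add_neg]
  refine ⟨μ, b, fun j => ?_⟩
  have key : (X : ℂ[X]) • b j = μ • b j + Ideal.Quotient.mk _ ((X - C μ) ^ ((j : ℕ) + 1)) := by
    rw [hb]
    have h1 : (X : ℂ[X]) * (X - C μ) ^ (j : ℕ) =
        μ • (X - C μ) ^ (j : ℕ) + (X - C μ) ^ ((j : ℕ) + 1) := by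
      rw [smul_eq_C_mul]; ring
    change Ideal.Quotient.mk _ ((X : ℂ[X]) * (X - C μ) ^ (j : ℕ)) = _
    rw [h1, map_add]
    rfl
  rw [key]
  congr 1
  split_ifs with h
  · rw [hb]
  · have he : (j : ℕ) + 1 = e := by omega
    rw [he]
    exact Ideal.Quotient.eq_zero_iff_mem.mpr
      (Ideal.mem_span_singleton.mpr (hass.pow_pow (n := e)).symm.dvd)

/-- Every operator on a finite-dimensional complex vector space has a Jordan decomposition. -/
theorem JordanDecomposition.nonempty [FiniteDimensional ℂ V] (T : Module.End ℂ V) :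
    Nonempty (JordanDecomposition T) := by
  classical
  obtain ⟨ι, _, p, hp, e, ⟨E⟩⟩ := Module.equiv_directSum_of_isTorsion
    (Module.AEval.isTorsion_of_finiteDimensional ℂ V T)
  choose μ b hb using fun i => exists_basis_quotient (p i) (hp i) (e i)
  let E' : V ≃ₗ[ℂ] DirectSum ι fun i => ℂ[X] ⧸ Submodule.span ℂ[X] {p i ^ e i} :=
    (Module.AEval'.of T).trans (E.restrictScalars ℂ)
  have hE' : ∀ w, T (E'.symm w) = E'.symm ((X : ℂ[X]) • w) := by
    intro w
    rw [LinearEquiv.eq_symm_apply]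
    change E (Module.AEval'.of T (T (E'.symm w))) = _
    rw [← Module.AEval'.X_smul_of, map_smul]
    congr 1
    exact E'.apply_symm_apply w
  let B : Module.Basis (Σ i, Fin (e i)) ℂ V := (DFinsupp.basis b).map E'.symm
  have hB : ∀ i j, B ⟨i, j⟩ = E'.symm (DirectSum.lof ℂ[X] ι _ i (b i j)) := by
    intro i j
    have : (DFinsupp.basis b) ⟨i, j⟩ = DirectSum.lof ℂ[X] ι _ i (b i j) := by
      rw [Module.Basis.apply_eq_iff]
      change (sigmaFinsuppLequivDFinsupp ℂ).symm (DFinsupp.mapRange.linearEquiv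
        (fun i => (b i).repr) (DFinsupp.single i (b i j))) = _
      rw [LinearEquiv.symm_apply_eq, DFinsupp.mapRange.linearEquiv_apply,
        DFinsupp.mapRange_single, Module.Basis.repr_self]
      exact (sigmaFinsuppEquivDFinsupp_single (⟨i, j⟩ : Σ i, Fin (e i)) (1 : ℂ)).symm
    simp only [B, Module.Basis.map_apply]
    rw [this]
  have hTB : ∀ i j, T (B ⟨i, j⟩) = μ i • B ⟨i, j⟩ +
      if h : (j : ℕ) + 1 < e i then B ⟨i, ⟨(j : ℕ) + 1, h⟩⟩ else 0 := by
    intro i j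
    have hC : ∀ x : ℂ[X] ⧸ Submodule.span ℂ[X] {p i ^ e i},
        DirectSum.lof ℂ[X] ι (fun i => ℂ[X] ⧸ Submodule.span ℂ[X] {p i ^ e i}) i (μ i • x) =
        μ i • DirectSum.lof ℂ[X] ι (fun i => ℂ[X] ⧸ Submodule.span ℂ[X] {p i ^ e i}) i x :=
      fun x => DFinsupp.single_smul
        (β := fun i => ℂ[X] ⧸ Submodule.span ℂ[X] {p i ^ e i}) (μ i) x
    rw [hB, hE', ← map_smul, hb, map_add, map_add, hC, map_smul]
    congr 1
    split_ifs with h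
    · rw [hB]
    · rw [map_zero, map_zero]
  let f := (Fintype.equivFin {i // 0 < e i}).symm
  let g : (Σ c : Fin (Fintype.card {i // 0 < e i}), Fin (e (f c))) ≃ Σ i, Fin (e i) :=
    Equiv.ofBijective (fun x => ⟨(f x.1 : ι), x.2⟩) (by
      constructor
      · rintro ⟨c, j⟩ ⟨c', j'⟩ h
        have h1 : (f c : ι) = f c' := congrArg Sigma.fst h
        obtain rfl : c = c' := f.injective (Subtype.ext h1)
        simpa using h
      · rintro ⟨i, j⟩
        obtain ⟨c, hc⟩ := f.surjective ⟨i, j.pos⟩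
        have hi : (f c : ι) = i := by rw [hc]
        subst hi
        exact ⟨⟨c, j⟩, rfl⟩)
  exact ⟨{
    numBlocks := Fintype.card {i // 0 < e i}
    eigenvalue := fun c => μ (f c)
    size := fun c => e (f c)
    size_pos := fun c => (f c).2
    basis := B.reindex g.symm
    map_basis := by
      intro c j
      simp only [Module.Basis.reindex_apply, Equiv.symm_symm]
      exact hTB (f c) j }⟩

namespace JordanDecomposition

variable {T : Module.End ℂ V} (J : JordanDecomposition T)

/-- The number of Jordan blocks of size `s` for the eigenvalue `μ`. -/
noncomputable def multiplicity (μ : ℂ) (s : ℕ) : ℕ :=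
  Nat.card {b : Fin J.numBlocks // J.eigenvalue b = μ ∧ J.size b = s}

open Classical in
/-- The set of sizes of the Jordan blocks for the eigenvalue `μ`. -/
noncomputable def sizes (μ : ℂ) : Finset ℕ :=
  (Finset.univ.filter fun b => J.eigenvalue b = μ).image J.size

/-- The sizes of the Jordan blocks for the eigenvalue `μ`, listed in increasing order without
repetition and indexed from `0`. -/
noncomputable def sizeSeq (μ : ℂ) : Fin (J.sizes μ).card ↪o ℕ :=
  (J.sizes μ).orderEmbOfFin rfl

/-- The block increments: the first size, and then the differences of successive sizes. -/
noncomputable def increment (μ : ℂ) (k : Fin (J.sizes μ).card) : ℕ :=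
  if (k : ℕ) = 0 then J.sizeSeq μ k
  else J.sizeSeq μ k - J.sizeSeq μ ⟨(k : ℕ) - 1, (Nat.sub_le _ _).trans_lt k.isLt⟩

/-- The tail sums of the sequence of multiplicities. -/
noncomputable def tailSum (μ : ℂ) (k : Fin (J.sizes μ).card) : ℕ :=
  ∑ l ∈ Finset.Ici k, J.multiplicity μ (J.sizeSeq μ l)

/-- The polynomial `∏_k ∑_{i=0}^{Δ_k} x ^ (i M_k)` attached to the eigenvalue `μ`. -/
noncomputable def genPoly (μ : ℂ) : ℕ[X] :=
  ∏ k : Fin (J.sizes μ).card, ∑ i ∈ Finset.range (J.increment μ k + 1), X ^ (i * J.tailSum μ k)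

end JordanDecomposition

end CentralizerOrbits

/-! Let `E` be the commutant algebra of `T`, so that `C(T)` is its unit group. The orbit of `v` lies
in the linear subspace `E v` and contains a nonempty principal open subset of it: a linear section
of `a ↦ a v` gives operators moving `v` to any nearby point, invertible where a determinant is
nonzero (`exists_principal_open_subset_orbit`). Hence the orbit has dimension `dim E v`, and since a
linear space is irreducible, two vectors with the same span lie in one orbit
(`mem_orbit_iff_cyclicSpan_eq`).

In a Jordan basis, a commuting operator maps `e_j` of a block `c` into a block `b` only if the
eigenvalues agree, and then into indices at least `j + max(0, size b - size c)`; shifts attain this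
bound. So `E v` is spanned by the basis vectors of index at least `d b` in each block `b`, where `d`
is the profile of `v` (`cyclicSpan_eq_heightSpan`), and `dim E v` is the sum of the coheights `size
b - d b`.

The profile inequalities say that, for each eigenvalue, the coheight depends only on the block size,
is nondecreasing in it, and grows no faster than it. Equivalently, its increments `a_k` are
arbitrary integers in `[0, Δ_k]`. The increment `a_k` counts once in every block of at least the
`k`-th size, so the dimension is `∑ a_k M_k`, whose generating function is the stated product. -/

namespace CentralizerOrbits

open Topology

universe u

/-! ### Increments and partial sums of finite sequences -/

/-- The increments of a finite sequence, starting with its first term. -/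
def increments {r : ℕ} (h : Fin r → ℕ) (k : Fin r) : ℕ :=
  if (k : ℕ) = 0 then h k else h k - h ⟨(k : ℕ) - 1, (Nat.sub_le _ _).trans_lt k.isLt⟩

theorem increments_zero {r : ℕ} (h : Fin r → ℕ) (hr : 0 < r) :
    increments h ⟨0, hr⟩ = h ⟨0, hr⟩ := if_pos rfl

theorem increments_succ {r : ℕ} (h : Fin r → ℕ) {k : ℕ} (hk : k + 1 < r) :
    increments h ⟨k + 1, hk⟩ = h ⟨k + 1, hk⟩ - h ⟨k, by omega⟩ := if_neg k.succ_ne_zero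

theorem sum_Iic_zero {r : ℕ} (a : Fin r → ℕ) (hr : 0 < r) :
    ∑ l ∈ Finset.Iic (⟨0, hr⟩ : Fin r), a l = a ⟨0, hr⟩ := by
  have : Finset.Iic (⟨0, hr⟩ : Fin r) = {⟨0, hr⟩} := by
    ext x
    simp [Fin.le_def, Fin.ext_iff]
  rw [this, Finset.sum_singleton]

theorem sum_Iic_succ {r : ℕ} (a : Fin r → ℕ) {k : ℕ} (hk : k + 1 < r) :
    ∑ l ∈ Finset.Iic (⟨k + 1, hk⟩ : Fin r), a l =
      ∑ l ∈ Finset.Iic (⟨k, by omega⟩ : Fin r), a l + a ⟨k + 1, hk⟩ := by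
  have : Finset.Iic (⟨k + 1, hk⟩ : Fin r) =
      insert ⟨k + 1, hk⟩ (Finset.Iic (⟨k, by omega⟩ : Fin r)) := by
    ext x
    simp only [Finset.mem_Iic, Finset.mem_insert, Fin.le_def, Fin.ext_iff]
    omega
  rw [this, Finset.sum_insert (by simp [Fin.le_def]), add_comm]

theorem sum_Iic_increments {r : ℕ} {h : Fin r → ℕ} (hh : Monotone h) (k : Fin r) :
    ∑ l ∈ Finset.Iic k, increments h l = h k := by
  obtain ⟨k, hk⟩ := k
  induction k with
  | zero => rw [sum_Iic_zero, increments_zero]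
  | succ k ih =>
    rw [sum_Iic_succ, ih, increments_succ, Nat.add_sub_cancel' (hh (by simp [Fin.le_def]))]

theorem increments_sum_Iic {r : ℕ} (a : Fin r → ℕ) :
    increments (fun k => ∑ l ∈ Finset.Iic k, a l) = a := by
  funext ⟨k, hk⟩
  cases k with
  | zero => rw [increments_zero, sum_Iic_zero]
  | succ k => rw [increments_succ, sum_Iic_succ, Nat.add_sub_cancel_left]

theorem increments_le {r : ℕ} {h s : Fin r → ℕ} (h0 : ∀ k, h k ≤ s k)
    (hs : ∀ k l, k ≤ l → h l ≤ h k + (s l - s k)) (k : Fin r) :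
    increments h k ≤ increments s k := by
  obtain ⟨k, hk⟩ := k
  cases k with
  | zero => simpa only [increments_zero] using h0 _
  | succ k =>
    have := hs ⟨k, by omega⟩ ⟨k + 1, hk⟩ (by simp [Fin.le_def])
    rw [increments_succ, increments_succ]
    omega

/-- Partial sums of a sequence bounded by the increments of `s` grow at most like `s`. -/
theorem sum_Iic_le_add {r : ℕ} {a s : Fin r → ℕ} (hs : Monotone s)
    (ha : ∀ k, a k ≤ increments s k) {k l : Fin r} (hkl : k ≤ l) :
    ∑ i ∈ Finset.Iic l, a i + s k ≤ ∑ i ∈ Finset.Iic k, a i + s l := by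
  have hsub : Finset.Iic k ⊆ Finset.Iic l := Finset.Iic_subset_Iic.mpr hkl
  rw [← sum_Iic_increments hs k, ← sum_Iic_increments hs l,
    ← Finset.sum_sdiff hsub, ← Finset.sum_sdiff (f := increments s) hsub]
  have := Finset.sum_le_sum fun i (_ : i ∈ Finset.Iic l \ Finset.Iic k) => ha i
  omega

theorem sum_Iic_le {r : ℕ} {a s : Fin r → ℕ} (hs : Monotone s)
    (ha : ∀ k, a k ≤ increments s k) (k : Fin r) : ∑ i ∈ Finset.Iic k, a i ≤ s k := by
  rw [← sum_Iic_increments hs k]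
  exact Finset.sum_le_sum fun i _ => ha i

variable {V : Type u} [AddCommGroup V] [Module ℂ V]

/-! ### Polynomial functions -/

theorem polynomialFunctions.linear_mem (φ : Module.Dual ℂ V) :
    (φ : V → ℂ) ∈ polynomialFunctions V :=
  Algebra.subset_adjoin ⟨φ, rfl⟩

theorem polynomialFunctions.const_mem (c : ℂ) :
    (fun _ => c : V → ℂ) ∈ polynomialFunctions V :=
  (polynomialFunctions V).algebraMap_mem c

/-- Polynomial functions are closed under substitution into polynomials. -/
theorem polynomialFunctions.aeval_mem {ι : Type*} (c : ι → V → ℂ)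
    (hc : ∀ i, c i ∈ polynomialFunctions V) (p : MvPolynomial ι ℂ) :
    (fun v => MvPolynomial.eval (fun i => c i v) p) ∈ polynomialFunctions V := by
  induction p using MvPolynomial.induction_on with
  | C a => simpa using const_mem a
  | add p q hp hq => simp only [map_add]; exact add_mem hp hq
  | mul_X p i hp => simp only [map_mul, MvPolynomial.eval_X]; exact mul_mem hp (hc i)

/-- The restriction of a polynomial function along a linear parametrization is a polynomial. -/
theorem polynomialFunctions.exists_mvPolynomial {ι : Type*} [Finite ι] (j : (ι → ℂ) →ₗ[ℂ] V)
    {f : V → ℂ} (hf : f ∈ polynomialFunctions V) :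
    ∃ p : MvPolynomial ι ℂ, ∀ x, f (j x) = MvPolynomial.eval x p := by
  classical
  cases nonempty_fintype ι
  induction hf using Algebra.adjoin_induction with
  | mem f hf =>
    obtain ⟨φ, rfl⟩ := hf
    refine ⟨∑ i, MvPolynomial.C (φ (j (Pi.single i 1))) * MvPolynomial.X i, fun x => ?_⟩
    have := LinearMap.pi_apply_eq_sum_univ (φ ∘ₗ j) x
    simp only [LinearMap.comp_apply] at this
    simp only [map_sum, map_mul, MvPolynomial.eval_C, MvPolynomial.eval_X]
    rw [this]
    refine Finset.sum_congr rfl fun i _ => ?_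
    rw [smul_eq_mul, mul_comm]
    congr 3
    ext k
    simp [Pi.single_apply, eq_comm]
  | algebraMap r => exact ⟨MvPolynomial.C r, fun x => by simp⟩
  | add f g _ _ hf hg =>
    obtain ⟨p, hp⟩ := hf
    obtain ⟨q, hq⟩ := hg
    exact ⟨p + q, fun x => by simp [hp, hq]⟩
  | mul f g _ _ hf hg =>
    obtain ⟨p, hp⟩ := hf
    obtain ⟨q, hq⟩ := hg
    exact ⟨p * q, fun x => by simp [hp, hq]⟩

/-- The restriction of a polynomial function to a line is a polynomial in one variable. -/
theorem polynomialFunctions.exists_polynomial_line (a b : V)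
    {f : V → ℂ} (hf : f ∈ polynomialFunctions V) :
    ∃ p : ℂ[X], ∀ t : ℂ, f (a + t • b) = p.eval t := by
  induction hf using Algebra.adjoin_induction with
  | mem f hf =>
    obtain ⟨φ, rfl⟩ := hf
    exact ⟨C (φ a) + C (φ b) * X, fun t => by simp [mul_comm (φ b)]⟩
  | algebraMap r => exact ⟨C r, fun x => by simp⟩
  | add f g _ _ hf hg =>
    obtain ⟨p, hp⟩ := hf
    obtain ⟨q, hq⟩ := hg
    exact ⟨p + q, fun x => by simp [hp, hq]⟩
  | mul f g _ _ hf hg =>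
    obtain ⟨p, hp⟩ := hf
    obtain ⟨q, hq⟩ := hg
    exact ⟨p * q, fun x => by simp [hp, hq]⟩

/-- Affine subspaces are irreducible: two polynomial functions that do not vanish identically on
`v + P` have a common point of non-vanishing. -/
theorem exists_mem_ne_zero_and_ne_zero (P : Submodule ℂ V) (v : V) {f g : V → ℂ}
    (hf : f ∈ polynomialFunctions V) (hg : g ∈ polynomialFunctions V)
    (hfa : ∃ a, a - v ∈ P ∧ f a ≠ 0) (hgb : ∃ b, b - v ∈ P ∧ g b ≠ 0) :
    ∃ c, c - v ∈ P ∧ f c ≠ 0 ∧ g c ≠ 0 := by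
  obtain ⟨a, ha, hfa⟩ := hfa
  obtain ⟨b, hb, hgb⟩ := hgb
  -- On the line through `a` and `b`, `f` is nonzero at parameter 0 and `g` at parameter 1, so both
  -- restrict to nonzero polynomials in one variable, and so does their product.
  obtain ⟨p, hp⟩ := polynomialFunctions.exists_polynomial_line a (b - a) hf
  obtain ⟨q, hq⟩ := polynomialFunctions.exists_polynomial_line a (b - a) hg
  have hp0 : p ≠ 0 := by
    rintro rfl
    have := hp 0
    simp at this
    exact hfa this
  have hq0 : q ≠ 0 := by
    rintro rfl
    have := hq 1
    simp at this
    exact hgb this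
  obtain ⟨t, ht⟩ : ∃ t, (p * q).eval t ≠ 0 := by
    by_contra! h
    exact mul_ne_zero hp0 hq0 (Polynomial.funext fun t => by simpa using h t)
  rw [eval_mul, ← hp, ← hq] at ht
  refine ⟨a + t • (b - a), ?_, left_ne_zero_of_mul ht, right_ne_zero_of_mul ht⟩
  have : a + t • (b - a) - v = (a - v) + t • ((b - v) - (a - v)) := by
    rw [sub_sub_sub_cancel_right]; abel
  rw [this]
  exact P.add_mem ha (P.smul_mem _ (P.sub_mem hb ha))

/-! ### The Zariski topology -/

theorem isClosed_zariski_iff {Z : Set V} :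
    IsClosed[zariskiTopology V] Z ↔
      ∃ S : Set (V → ℂ), S ⊆ polynomialFunctions V ∧ Z = zeroLocus S := by
  let _ := zariskiTopology V
  rw [← isOpen_compl_iff]
  change Zᶜᶜ ∈ {Z : Set V | ∃ S : Set (V → ℂ), S ⊆ polynomialFunctions V ∧ Z = zeroLocus S} ↔ _
  rw [compl_compl]
  rfl

theorem isClosed_zariski_zeroLocus {S : Set (V → ℂ)} (hS : S ⊆ polynomialFunctions V) :
    IsClosed[zariskiTopology V] (zeroLocus S) :=
  isClosed_zariski_iff.mpr ⟨S, hS, rfl⟩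

/-- The functionals annihilating `P`, each shifted by its value at `v`, cut out the translate. -/
theorem isClosed_zariski_affine (P : Submodule ℂ V) (v : V) :
    IsClosed[zariskiTopology V] {w | w - v ∈ P} := by
  refine isClosed_zariski_iff.mpr
    ⟨(fun φ : Module.Dual ℂ V => fun w => φ w - φ v) '' (P.dualAnnihilator : Set _), ?_, ?_⟩
  · rintro _ ⟨φ, -, rfl⟩
    exact sub_mem (polynomialFunctions.linear_mem φ) (polynomialFunctions.const_mem (φ v))
  · ext w
    simp only [Set.mem_ofPred_eq, zeroLocus, Set.forall_mem_image, SetLike.mem_coe]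
    rw [← Subspace.forall_mem_dualAnnihilator_apply_eq_zero_iff]
    simp only [map_sub]

/-- Polynomial functions test irreducibility: one direction. -/
theorem eq_zero_or_eq_zero_of_isIrreducible {O : Set V} {Z : Set O}
    (hZ : @IsIrreducible O (@instTopologicalSpaceSubtype V (· ∈ O) (zariskiTopology V)) Z)
    {f g : V → ℂ} (hf : f ∈ polynomialFunctions V) (hg : g ∈ polynomialFunctions V)
    (h : ∀ x ∈ Z, f x * g x = 0) : (∀ x ∈ Z, f x = 0) ∨ (∀ x ∈ Z, g x = 0) := by
  let _ := zariskiTopology V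
  have hcl : ∀ f ∈ polynomialFunctions V, IsClosed {x : O | f x = 0} := fun f hf => by
    have h := (isClosed_zariski_zeroLocus (S := {f}) (by simpa using hf)).preimage
      (continuous_subtype_val (p := (· ∈ O)))
    simpa [zeroLocus] using h
  exact isPreirreducible_iff_isClosed_union_isClosed.mp hZ.2 _ _ (hcl f hf) (hcl g hg)
    fun x hx => mul_eq_zero.mp (h x hx)

/-- Polynomial functions test irreducibility: the other direction. -/
theorem isIrreducible_of_eq_zero_or_eq_zero {O : Set V} {Z : Set O} (hne : Z.Nonempty)
    (h : ∀ f ∈ polynomialFunctions V, ∀ g ∈ polynomialFunctions V,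
      (∃ x ∈ Z, f x ≠ 0) → (∃ x ∈ Z, g x ≠ 0) → ∃ x ∈ Z, f x ≠ 0 ∧ g x ≠ 0) :
    @IsIrreducible O (@instTopologicalSpaceSubtype V (· ∈ O) (zariskiTopology V)) Z := by
  let _ := zariskiTopology V
  refine ⟨hne, isPreirreducible_iff_isClosed_union_isClosed.mpr ?_⟩
  intro z₁ z₂ h₁ h₂ hZ
  obtain ⟨t₁, ht₁, rfl⟩ := isClosed_induced_iff.mp h₁
  obtain ⟨t₂, ht₂, rfl⟩ := isClosed_induced_iff.mp h₂
  obtain ⟨S₁, hS₁, rfl⟩ := isClosed_zariski_iff.mp ht₁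
  obtain ⟨S₂, hS₂, rfl⟩ := isClosed_zariski_iff.mp ht₂
  by_contra hcon
  simp only [Set.not_subset, Set.mem_preimage, zeroLocus, Set.mem_ofPred_eq, not_or,
    not_forall] at hcon
  obtain ⟨⟨a, ha, f, hf, hfa⟩, ⟨b, hb, g, hg, hgb⟩⟩ := hcon
  obtain ⟨x, hx, hfx, hgx⟩ := h f (hS₁ hf) g (hS₂ hg) ⟨a, ha, hfa⟩ ⟨b, hb, hgb⟩
  exact (hZ hx).elim (fun h => hfx (h f hf)) (fun h => hgx (h g hg))

/-! ### Dimension of dense subsets of linear subspaces -/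

/-- The vanishing ideal in `ℂ[x_1, …, x_m]` of a set of points of `V` with given coordinates. -/
def vanishingIdealOf {ι : Type*} (c : V →ₗ[ℂ] (ι → ℂ)) (Z : Set V) :
    Ideal (MvPolynomial ι ℂ) where
  carrier := {p | ∀ z ∈ Z, MvPolynomial.eval (c z) p = 0}
  add_mem' := fun hp hq z hz => by simp [hp z hz, hq z hz]
  zero_mem' := fun z _ => by simp
  smul_mem' := fun r p hp z hz => by simp [hp z hz]

theorem mem_vanishingIdealOf {ι : Type*} {c : V →ₗ[ℂ] (ι → ℂ)} {Z : Set V}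
    {p : MvPolynomial ι ℂ} :
    p ∈ vanishingIdealOf c Z ↔ ∀ z ∈ Z, MvPolynomial.eval (c z) p = 0 := Iff.rfl

theorem coordinates_mem {ι : Type*} (c : V →ₗ[ℂ] (ι → ℂ)) (p : MvPolynomial ι ℂ) :
    (fun v => MvPolynomial.eval (c v) p) ∈ polynomialFunctions V :=
  polynomialFunctions.aeval_mem (fun i v => c v i)
    (fun i => polynomialFunctions.linear_mem (LinearMap.proj i ∘ₗ c)) p

theorem vanishingIdealOf_isPrime {ι : Type*} (c : V →ₗ[ℂ] (ι → ℂ)) {O : Set V} {Z : Set O}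
    (hZ : @IsIrreducible O (@instTopologicalSpaceSubtype V (· ∈ O) (zariskiTopology V)) Z) :
    (vanishingIdealOf c (Subtype.val '' Z)).IsPrime := by
  refine ⟨?_, ?_⟩
  · intro h
    obtain ⟨z, hz⟩ := hZ.1
    have := (Ideal.eq_top_iff_one _).mp h z ⟨z, hz, rfl⟩
    simp at this
  · intro p q hpq
    simp only [mem_vanishingIdealOf, Set.forall_mem_image, map_mul] at hpq ⊢
    exact eq_zero_or_eq_zero_of_isIrreducible hZ (coordinates_mem c p) (coordinates_mem c q) hpq

/-- Vanishing ideals send chains of irreducible closed subsets of `O` to chains of primes in a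
polynomial ring in `dim W` variables, reversing order. Strictness needs no Nullstellensatz: a closed
set is recovered from the polynomials vanishing on it. -/
theorem algebraicDim_le_finrank [FiniteDimensional ℂ V] (W : Submodule ℂ V) {O : Set V}
    (hO : O ⊆ W) : algebraicDim O ≤ (Module.finrank ℂ W : WithBot ℕ∞) := by
  let _ := zariskiTopology V
  let e := (Module.finBasis ℂ W).equivFun
  obtain ⟨c, hc⟩ := LinearMap.exists_extend (e : W →ₗ[ℂ] (Fin (Module.finrank ℂ W) → ℂ))
  let j : (Fin (Module.finrank ℂ W) → ℂ) →ₗ[ℂ] V := W.subtype ∘ₗ e.symm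
  have hjc : ∀ w ∈ W, j (c w) = w := fun w hw => by
    have : c w = e ⟨w, hw⟩ := LinearMap.congr_fun hc ⟨w, hw⟩
    simp [j, this]
  have hdim : ringKrullDim (MvPolynomial (Fin (Module.finrank ℂ W)) ℂ) =
      (Module.finrank ℂ W : WithBot ℕ∞) := by
    rw [MvPolynomial.ringKrullDim_of_isNoetherianRing]
    simp
  rw [← hdim, ringKrullDim, ← Order.krullDim_orderDual]
  let F : TopologicalSpace.IrreducibleCloseds O →
      (PrimeSpectrum (MvPolynomial (Fin (Module.finrank ℂ W)) ℂ))ᵒᵈ := fun Z =>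
    OrderDual.toDual ⟨vanishingIdealOf c (Subtype.val '' (Z : Set O)),
      vanishingIdealOf_isPrime c Z.isIrreducible⟩
  refine Order.krullDim_le_of_strictMono F ?_
  have hmono : ∀ Z Z', Z ≤ Z' ↔ F Z ≤ F Z' := by
    intro Z Z'
    constructor
    · intro h p hp z hz
      exact hp z (Set.image_mono h hz)
    · intro h z hz
      obtain ⟨t, ht, htZ⟩ := isClosed_induced_iff.mp Z'.isClosed
      obtain ⟨S, hS, rfl⟩ := isClosed_zariski_iff.mp ht
      change z ∈ (Z' : Set O)
      rw [← htZ]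
      intro f hf
      -- In coordinates on `W`, an equation `f` of `Z'` is a polynomial in the ideal of `Z'`, hence
      -- in the ideal of `Z`.
      obtain ⟨p, hp⟩ := polynomialFunctions.exists_mvPolynomial j (hS hf)
      have hp' : ∀ w ∈ W, f w = MvPolynomial.eval (c w) p := fun w hw => by
        rw [← hp, hjc w hw]
      rw [hp' z (hO z.2)]
      refine (show p ∈ vanishingIdealOf c (Subtype.val '' (Z : Set O)) from h ?_) z ⟨z, hz, rfl⟩
      rintro _ ⟨x, hx, rfl⟩
      rw [← hp' x (hO x.2)]
      rw [← htZ] at hx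
      exact hx f hf
  intro Z Z' h
  rw [lt_iff_le_not_ge] at h ⊢
  rwa [← hmono, ← hmono]

/-- A full flag of `W` translated to pass through `v` and intersected with `O` is a strict chain of
irreducible closed subsets of length `dim W`. -/
theorem finrank_le_algebraicDim [FiniteDimensional ℂ V] (W : Submodule ℂ V) {O : Set V}
    {v : V} (hv : v ∈ W) {q : V → ℂ} (hq : q ∈ polynomialFunctions V) (hqv : q v ≠ 0)
    (hO : ∀ w ∈ W, q w ≠ 0 → w ∈ O) : (Module.finrank ℂ W : WithBot ℕ∞) ≤ algebraicDim O := by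
  let _ := zariskiTopology V
  let b := Module.finBasis ℂ W
  let P : ℕ → Submodule ℂ V := fun i =>
    (Submodule.span ℂ (b '' {k | (k : ℕ) < i})).map W.subtype
  have hPW : ∀ i, P i ≤ W := fun i => Submodule.map_subtype_le _ _
  have hPO : ∀ i w, w - v ∈ P i → q w ≠ 0 → w ∈ O := fun i w hw hqw =>
    hO w (by simpa using W.add_mem (hPW i hw) hv) hqw
  have hmono : Monotone P := fun i k hik => Submodule.map_mono (Submodule.span_mono
    (Set.image_mono fun x (hx : (x : ℕ) < i) => lt_of_lt_of_le hx hik))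
  let Z : ℕ → TopologicalSpace.IrreducibleCloseds O := fun i =>
    { carrier := {x : O | (x : V) - v ∈ P i}
      isIrreducible' := by
        refine isIrreducible_of_eq_zero_or_eq_zero
          ⟨⟨v, hO v hv hqv⟩, by simp⟩ ?_
        rintro f hf g hg ⟨a, ha, hfa⟩ ⟨b, hb, hgb⟩
        -- Irreducibility of the affine space is used twice, to make `f`, `q` and `g` nonzero at one
        -- point; `q ≠ 0` puts that point in `O`.
        obtain ⟨c, hc, hfc, hqc⟩ := exists_mem_ne_zero_and_ne_zero (P i) v hf hq ⟨a, ha, hfa⟩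
          ⟨v, by simp, hqv⟩
        obtain ⟨d, hd, hfd, hgd⟩ := exists_mem_ne_zero_and_ne_zero (P i) v (mul_mem hf hq) hg
          ⟨c, hc, mul_ne_zero hfc hqc⟩ ⟨b, hb, hgb⟩
        exact ⟨⟨d, hPO i d hd (right_ne_zero_of_mul hfd)⟩, hd, left_ne_zero_of_mul hfd, hgd⟩
      isClosed' := (isClosed_zariski_affine (P i) v).preimage continuous_subtype_val }
  have hlt : ∀ i, i < Module.finrank ℂ W → Z i < Z (i + 1) := by
    intro i hi
    refine lt_iff_le_not_ge.mpr ⟨fun x hx => hmono i.le_succ hx, fun hle => ?_⟩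
    obtain ⟨p, hp⟩ := polynomialFunctions.exists_polynomial_line v (b ⟨i, hi⟩ : V) hq
    have hp0 : p ≠ 0 := by
      rintro rfl
      have := hp 0
      simp at this
      exact hqv this
    -- The factor `X` forces `t ≠ 0`, so the point leaves `P i`; the factor `p` keeps it in `O`.
    obtain ⟨t, ht⟩ : ∃ t, (p * X).eval t ≠ 0 := by
      by_contra! h
      exact mul_ne_zero hp0 X_ne_zero (Polynomial.funext fun t => by simpa using h t)
    rw [eval_mul, ← hp, eval_X] at ht
    have hmem : v + t • (b ⟨i, hi⟩ : V) - v ∈ P (i + 1) := by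
      rw [add_sub_cancel_left]
      exact Submodule.smul_mem _ _ (Submodule.mem_map_of_mem (f := W.subtype)
        (Submodule.subset_span ⟨⟨i, hi⟩, Nat.lt_succ_self i, rfl⟩))
    have h1 : (⟨_, hPO _ _ hmem (left_ne_zero_of_mul ht)⟩ : O) ∈ Z i := hle hmem
    have h2 : v + t • (b ⟨i, hi⟩ : V) - v ∈ P i := h1
    rw [add_sub_cancel_left] at h2
    obtain ⟨w, hw, hwb⟩ := (Submodule.smul_mem_iff _ (right_ne_zero_of_mul ht)).mp h2
    obtain rfl : w = b ⟨i, hi⟩ := Subtype.ext hwb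
    exact b.linearIndependent.notMem_span_image (s := {k | (k : ℕ) < i}) (x := ⟨i, hi⟩)
      (by simp) hw
  refine Order.le_krullDim_iff.mpr ⟨⟨Module.finrank ℂ W, fun i => Z i, fun i => ?_⟩, rfl⟩
  exact hlt i i.2

/-- A subset of a linear subspace that contains a nonempty principal open subset of it has the
dimension of the subspace. -/
theorem algebraicDim_eq_finrank [FiniteDimensional ℂ V] (W : Submodule ℂ V) {O : Set V}
    (hOW : O ⊆ W) {v : V} (hv : v ∈ W) {q : V → ℂ} (hq : q ∈ polynomialFunctions V)
    (hqv : q v ≠ 0) (hO : ∀ w ∈ W, q w ≠ 0 → w ∈ O) :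
    algebraicDim O = (Module.finrank ℂ W : WithBot ℕ∞) :=
  (algebraicDim_le_finrank W hOW).antisymm (finrank_le_algebraicDim W hv hq hqv hO)

/-! ### Orbits and cyclic submodules over the commutant -/

/-- The submodule `{a v : a T = T a}` generated by `v` over the commutant algebra of `T`. -/
def cyclicSpan (T : Module.End ℂ V) (v : V) : Submodule ℂ V :=
  (Subalgebra.toSubmodule (Subalgebra.centralizer ℂ {T})).map (LinearMap.applyₗ v)

theorem mem_cyclicSpan {T : Module.End ℂ V} {v w : V} :
    w ∈ cyclicSpan T v ↔ ∃ a : Module.End ℂ V, Commute T a ∧ a v = w := by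
  simp [cyclicSpan, Subalgebra.mem_centralizer_iff, Commute, SemiconjBy]

theorem self_mem_cyclicSpan (T : Module.End ℂ V) (v : V) : v ∈ cyclicSpan T v :=
  mem_cyclicSpan.mpr ⟨1, Commute.one_right T, rfl⟩

theorem map_mem_cyclicSpan {T a : Module.End ℂ V} (ha : Commute T a) {v w : V}
    (hw : w ∈ cyclicSpan T v) : a w ∈ cyclicSpan T v := by
  obtain ⟨c, hc, rfl⟩ := mem_cyclicSpan.mp hw
  exact mem_cyclicSpan.mpr ⟨a * c, ha.mul_right hc, rfl⟩

theorem cyclicSpan_le_iff {T : Module.End ℂ V} {v w : V} :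
    cyclicSpan T w ≤ cyclicSpan T v ↔ w ∈ cyclicSpan T v := by
  refine ⟨fun h => h (self_mem_cyclicSpan T w), fun hw x hx => ?_⟩
  obtain ⟨c, hc, rfl⟩ := mem_cyclicSpan.mp hx
  exact map_mem_cyclicSpan hc hw

theorem commute_of_mem_centralizerGroup {T : Module.End ℂ V} (g : centralizerGroup T) :
    Commute T ((g : V ≃ₗ[ℂ] V) : Module.End ℂ V) :=
  LinearMap.ext fun v => (g.2 v).symm

theorem cyclicSpan_smul {T : Module.End ℂ V} (g : centralizerGroup T) (v : V) :
    cyclicSpan T (g • v) = cyclicSpan T v := by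
  have key : ∀ (g : centralizerGroup T) (v : V), cyclicSpan T (g • v) ≤ cyclicSpan T v :=
    fun g v => cyclicSpan_le_iff.mpr
      (mem_cyclicSpan.mpr ⟨_, commute_of_mem_centralizerGroup g, rfl⟩)
  refine (key g v).antisymm ?_
  simpa using key g⁻¹ (g • v)

theorem det_mem_polynomialFunctions [FiniteDimensional ℂ V] {A : V → Module.End ℂ V}
    (hA : ∀ (φ : Module.Dual ℂ V) (x : V), (fun w => φ (A w x)) ∈ polynomialFunctions V) :
    (fun w => LinearMap.det (A w)) ∈ polynomialFunctions V := by
  classical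
  let b := Module.finBasis ℂ V
  have : (fun w => LinearMap.det (A w)) = ∑ σ : Equiv.Perm (Fin (Module.finrank ℂ V)),
      Equiv.Perm.sign σ • ∏ i, fun w => b.coord (σ i) (A w (b i)) := by
    ext w
    rw [← LinearMap.det_toMatrix b, Matrix.det_apply, Finset.sum_apply]
    refine Finset.sum_congr rfl fun σ _ => ?_
    simp [LinearMap.toMatrix_apply, Finset.prod_apply, Pi.smul_apply]
  rw [this]
  refine sum_mem fun σ _ => ?_
  rw [Units.smul_def]
  exact zsmul_mem (prod_mem fun i _ => hA _ _) _

/-- The orbit of `v` contains a principal open neighbourhood of `v` in its cyclic span. -/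
theorem exists_principal_open_subset_orbit [FiniteDimensional ℂ V] (T : Module.End ℂ V) (v : V) :
    ∃ q ∈ polynomialFunctions V, q v ≠ 0 ∧
      ∀ w ∈ cyclicSpan T v, q w ≠ 0 → w ∈ MulAction.orbit (centralizerGroup T) v := by
  let E := Subalgebra.toSubmodule (Subalgebra.centralizer ℂ {T})
  let f : E →ₗ[ℂ] cyclicSpan T v := (LinearMap.applyₗ v).submoduleMap E
  -- A linear section of `a ↦ a v`, extended to all of `V` so that its entries are polynomial
  -- functions there.
  obtain ⟨s, hs⟩ := LinearMap.exists_rightInverse_of_surjective f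
    (LinearMap.range_eq_top.mpr (LinearMap.submoduleMap_surjective _ _))
  obtain ⟨s', hs'⟩ := LinearMap.exists_extend s
  have hsw : ∀ w ∈ cyclicSpan T v, (s' w : Module.End ℂ V) v = w := fun w hw => by
    have h1 : s' w = s ⟨w, hw⟩ := LinearMap.congr_fun hs' ⟨w, hw⟩
    have h2 : f (s ⟨w, hw⟩) = ⟨w, hw⟩ := LinearMap.congr_fun hs ⟨w, hw⟩
    rw [h1]
    exact congrArg Subtype.val h2
  -- The correction `1 - s' v` commutes with `T` and kills `v`, so `A w` still maps `v` to `w`,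
  -- while `A v = 1` has nonzero determinant.
  let A : V → Module.End ℂ V := fun w => s' w + (1 - s' v)
  have hcomm : ∀ a : E, Commute T (a : Module.End ℂ V) := fun a =>
    Subalgebra.mem_centralizer_iff ℂ |>.mp a.2 T rfl
  refine ⟨fun w => LinearMap.det (A w), det_mem_polynomialFunctions fun φ x => ?_, ?_, ?_⟩
  · have h : (fun w => φ (A w x)) = ((φ ∘ₗ (LinearMap.applyₗ x) ∘ₗ E.subtype ∘ₗ s' :
        Module.Dual ℂ V) : V → ℂ) + fun _ => φ ((1 - (s' v : Module.End ℂ V)) x) := by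
      ext w
      simp [A]
    rw [h]
    exact add_mem (polynomialFunctions.linear_mem _) (polynomialFunctions.const_mem _)
  · simp [A]
  · intro w hw hdet
    refine ⟨⟨LinearMap.equivOfDetNeZero (A w) hdet, fun x => ?_⟩, ?_⟩
    · have : Commute T (A w) := (hcomm _).add_right ((Commute.one_right T).sub_right (hcomm _))
      exact (LinearMap.congr_fun this x).symm
    · change (s' w : Module.End ℂ V) v + (v - (s' v : Module.End ℂ V) v) = w
      rw [hsw w hw, hsw v (self_mem_cyclicSpan T v), sub_self, add_zero]

theorem algebraicDim_orbit [FiniteDimensional ℂ V] (T : Module.End ℂ V) (v : V) :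
    algebraicDim (MulAction.orbit (centralizerGroup T) v) =
      (Module.finrank ℂ (cyclicSpan T v) : WithBot ℕ∞) := by
  obtain ⟨q, hq, hqv, h⟩ := exists_principal_open_subset_orbit T v
  refine algebraicDim_eq_finrank _ ?_ (self_mem_cyclicSpan T v) hq hqv h
  rintro _ ⟨g, rfl⟩
  exact (cyclicSpan_smul g v).le (self_mem_cyclicSpan T _)

theorem mem_orbit_iff_cyclicSpan_eq [FiniteDimensional ℂ V] {T : Module.End ℂ V} {v w : V} :
    v ∈ MulAction.orbit (centralizerGroup T) w ↔ cyclicSpan T v = cyclicSpan T w := by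
  constructor
  · rintro ⟨g, rfl⟩
    exact cyclicSpan_smul g w
  · intro h
    obtain ⟨p, hp, hpv, hpO⟩ := exists_principal_open_subset_orbit T v
    obtain ⟨q, hq, hqw, hqO⟩ := exists_principal_open_subset_orbit T w
    have hv : v ∈ cyclicSpan T w := h ▸ self_mem_cyclicSpan T v
    -- Both orbits contain nonempty open subsets of the same irreducible space, so they meet.
    obtain ⟨c, hc, hpc, hqc⟩ := exists_mem_ne_zero_and_ne_zero (cyclicSpan T w) 0 hp hq
      ⟨v, by simpa using hv, hpv⟩ ⟨w, by simpa using self_mem_cyclicSpan T w, hqw⟩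
    rw [sub_zero] at hc
    have h1 := MulAction.orbit_eq_iff.mpr (hpO c (h ▸ hc) hpc)
    have h2 := MulAction.orbit_eq_iff.mpr (hqO c hc hqc)
    rw [← h2, h1]
    exact MulAction.mem_orbit_self v

namespace JordanDecomposition

variable {T : Module.End ℂ V} (J : JordanDecomposition T)

/-! ### Coordinates in a Jordan basis -/

/-- The vector `e_j` of the block `b`, with the convention that it vanishes beyond the block. -/
noncomputable def vec (b : Fin J.numBlocks) (j : ℕ) : V :=
  if h : j < J.size b then J.basis ⟨b, ⟨j, h⟩⟩ else 0

/-- The coordinate functional dual to `J.vec b j`, zero beyond the block. -/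
noncomputable def coordinate (b : Fin J.numBlocks) (j : ℕ) : Module.Dual ℂ V :=
  if h : j < J.size b then J.basis.coord ⟨b, ⟨j, h⟩⟩ else 0

theorem vec_of_lt {b : Fin J.numBlocks} {j : ℕ} (h : j < J.size b) :
    J.vec b j = J.basis ⟨b, ⟨j, h⟩⟩ := dif_pos h

theorem vec_of_le {b : Fin J.numBlocks} {j : ℕ} (h : J.size b ≤ j) : J.vec b j = 0 :=
  dif_neg h.not_gt

theorem basis_eq_vec (x : Σ b : Fin J.numBlocks, Fin (J.size b)) :
    J.basis x = J.vec x.1 x.2 := (J.vec_of_lt x.2.2).symm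

theorem coordinate_of_lt {b : Fin J.numBlocks} {j : ℕ} (h : j < J.size b) :
    J.coordinate b j = J.basis.coord ⟨b, ⟨j, h⟩⟩ := dif_pos h

theorem coordinate_of_le {b : Fin J.numBlocks} {j : ℕ} (h : J.size b ≤ j) :
    J.coordinate b j = 0 := dif_neg h.not_gt

theorem coordinate_vec (b c : Fin J.numBlocks) (i j : ℕ) :
    J.coordinate b i (J.vec c j) = if b = c ∧ i = j ∧ j < J.size c then 1 else 0 := by
  by_cases hi : i < J.size b
  · by_cases hj : j < J.size c
    · rw [J.coordinate_of_lt hi, J.vec_of_lt hj, Module.Basis.coord_apply,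
        Module.Basis.repr_self, Finsupp.single_apply]
      congr 1
      simp only [Sigma.mk.injEq, hj, and_true, eq_iff_iff]
      constructor
      · rintro ⟨rfl, h⟩
        simpa [eq_comm] using h
      · rintro ⟨rfl, rfl⟩
        simp
    · rw [J.vec_of_le (not_lt.mp hj), map_zero, if_neg (fun h => hj h.2.2)]
  · rw [J.coordinate_of_le (not_lt.mp hi), LinearMap.zero_apply, if_neg]
    rintro ⟨rfl, rfl, h⟩
    exact hi h

theorem map_vec (b : Fin J.numBlocks) (j : ℕ) :
    T (J.vec b j) = J.eigenvalue b • J.vec b j + J.vec b (j + 1) := by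
  by_cases h : j < J.size b
  · rw [J.vec_of_lt h, J.map_basis]
    rfl
  · rw [J.vec_of_le (not_lt.mp h), J.vec_of_le (by omega), map_zero, smul_zero, add_zero]

theorem coordinate_map_zero (b : Fin J.numBlocks) (x : V) :
    J.coordinate b 0 (T x) = J.eigenvalue b * J.coordinate b 0 x := by
  have : J.coordinate b 0 ∘ₗ T = J.eigenvalue b • J.coordinate b 0 := by
    refine J.basis.ext fun y => ?_
    rw [basis_eq_vec]
    simp only [LinearMap.comp_apply, LinearMap.smul_apply, map_vec, map_add, map_smul,
      coordinate_vec, smul_eq_mul]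
    by_cases hb : b = y.1 <;> simp [hb]
  exact LinearMap.congr_fun this x

theorem coordinate_map_succ (b : Fin J.numBlocks) {i : ℕ} (hi : i + 1 < J.size b) (x : V) :
    J.coordinate b (i + 1) (T x) =
      J.eigenvalue b * J.coordinate b (i + 1) x + J.coordinate b i x := by
  have : J.coordinate b (i + 1) ∘ₗ T =
      J.eigenvalue b • J.coordinate b (i + 1) + J.coordinate b i := by
    refine J.basis.ext fun y => ?_
    rw [basis_eq_vec]
    simp only [LinearMap.comp_apply, LinearMap.smul_apply, map_vec, map_add, map_smul,
      coordinate_vec, smul_eq_mul, LinearMap.add_apply]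
    by_cases hb : b = y.1
    · subst hb
      have : (i = (y.2 : ℕ) ∧ (y.2 : ℕ) + 1 < J.size y.1) ↔ (i = (y.2 : ℕ)) :=
        ⟨fun h => h.1, fun h => ⟨h, h ▸ hi⟩⟩
      by_cases h1 : i + 1 = (y.2 : ℕ) 
      · simp [h1, show i ≠ (y.2 : ℕ) by omega]
      · simp [h1, this]
    · simp [hb]
  exact LinearMap.congr_fun this x

/-- `T - μ` acts on the coordinates of a block with eigenvalue `μ` by a shift. -/
theorem coordinate_pow_sub (b : Fin J.numBlocks) (k : ℕ) {i : ℕ} (hi : i + k < J.size b) (x : V) :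
    J.coordinate b (i + k) (((T - algebraMap ℂ _ (J.eigenvalue b)) ^ k) x) =
      J.coordinate b i x := by
  induction k generalizing x with
  | zero => simp
  | succ k ih =>
    rw [pow_succ', Module.End.mul_apply, ← add_assoc]
    have : i + k + 1 < J.size b := by omega
    rw [LinearMap.sub_apply, map_sub, J.coordinate_map_succ b this, Module.algebraMap_end_apply,
      map_smul, smul_eq_mul, add_sub_cancel_left]
    exact ih (by omega) x

theorem coordinate_pow_sub_of_lt (b : Fin J.numBlocks) (k : ℕ) {i : ℕ} (hi : i < k) (x : V) :
    J.coordinate b i (((T - algebraMap ℂ _ (J.eigenvalue b)) ^ k) x) = 0 := by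
  induction k generalizing i x with
  | zero => omega
  | succ k ih =>
    rcases lt_or_ge i (J.size b) with hs | hs
    · rw [pow_succ', Module.End.mul_apply, LinearMap.sub_apply, map_sub,
        Module.algebraMap_end_apply, map_smul, smul_eq_mul]
      cases i with
      | zero => rw [coordinate_map_zero, sub_self]
      | succ i => rw [J.coordinate_map_succ b hs, add_sub_cancel_left, ih (by omega)]
    · rw [J.coordinate_of_le hs, LinearMap.zero_apply]

/-- `T - μ` is injective on blocks with eigenvalue different from `μ`. -/
theorem coordinate_eq_zero_of_pow_sub {b : Fin J.numBlocks} {μ : ℂ} (hμ : J.eigenvalue b ≠ μ)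
    (k : ℕ) (x : V) (hx : ∀ i, J.coordinate b i (((T - algebraMap ℂ _ μ) ^ k) x) = 0) (i : ℕ) :
    J.coordinate b i x = 0 := by
  induction k generalizing x i with
  | zero => simpa using hx i
  | succ k ih =>
    refine ih x (fun i => ?_) i
    set y := ((T - algebraMap ℂ _ μ) ^ k) x
    have hy : ∀ i, J.coordinate b i (T y) = μ * J.coordinate b i y := fun i => by
      have := hx i
      rw [pow_succ', Module.End.mul_apply, LinearMap.sub_apply, map_sub,
        Module.algebraMap_end_apply, map_smul, smul_eq_mul, sub_eq_zero] at this
      exact this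
    have hcancel : ∀ z : ℂ, J.eigenvalue b * z = μ * z → z = 0 := fun z hz => by
      by_contra h
      exact hμ (mul_right_cancel₀ h hz)
    -- `y` is an eigenvector as seen by block `b`, with the wrong eigenvalue: its coordinates vanish
    -- successively from index 0 upwards.
    induction i with
    | zero => exact hcancel _ (by rw [← hy, coordinate_map_zero])
    | succ i ih' =>
      rcases lt_or_ge (i + 1) (J.size b) with hs | hs
      · have := hy (i + 1)
        rw [J.coordinate_map_succ b hs, ih', add_zero] at this
        exact hcancel _ this
      · rw [J.coordinate_of_le hs, LinearMap.zero_apply]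

theorem pow_sub_vec (b : Fin J.numBlocks) (k j : ℕ) :
    ((T - algebraMap ℂ _ (J.eigenvalue b)) ^ k) (J.vec b j) = J.vec b (j + k) := by
  induction k generalizing j with
  | zero => simp
  | succ k ih =>
    rw [pow_succ, Module.End.mul_apply, LinearMap.sub_apply, map_vec, Module.algebraMap_end_apply,
      add_sub_cancel_left, ih]
    congr 1
    omega

theorem commute_pow_sub {a : Module.End ℂ V} (ha : Commute T a) (μ : ℂ) (k : ℕ) :
    Commute ((T - algebraMap ℂ _ μ) ^ k) a :=
  (ha.sub_left (Algebra.commute_algebraMap_left μ a)).pow_left k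

/-- The coordinates of the image of a Jordan basis vector under an operator in the commutant. -/
theorem coordinate_commute_vec {a : Module.End ℂ V} (ha : Commute T a) {b c : Fin J.numBlocks}
    {i j : ℕ} (h : J.coordinate b i (a (J.vec c j)) ≠ 0) :
    J.eigenvalue b = J.eigenvalue c ∧ j + (J.size b - J.size c) ≤ i := by
  have hcomm : ∀ (k : ℕ) (x : V), ((T - algebraMap ℂ _ (J.eigenvalue c)) ^ k) (a x) =
      a (((T - algebraMap ℂ _ (J.eigenvalue c)) ^ k) x) := fun k x =>
    LinearMap.congr_fun (commute_pow_sub ha (J.eigenvalue c) k).eq x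
  have hbc : J.eigenvalue b = J.eigenvalue c := by
    by_contra hne
    -- The power `size c` of `T - μ` kills `e_j`, hence its image, but is injective on blocks with
    -- another eigenvalue.
    refine h (J.coordinate_eq_zero_of_pow_sub hne (J.size c) _ (fun i => ?_) i)
    rw [hcomm, pow_sub_vec, J.vec_of_le (by omega), map_zero, map_zero]
  refine ⟨hbc, ?_⟩
  have hj : j ≤ i := by
    by_contra hlt
    -- Being in the image of the `j`-th power of `T - μ` is preserved by `a` and makes the
    -- coordinates below `j` vanish.
    have : J.vec c j = ((T - algebraMap ℂ _ (J.eigenvalue c)) ^ j) (J.vec c 0) := by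
      rw [pow_sub_vec, zero_add]
    rw [this, ← hcomm, ← hbc, J.coordinate_pow_sub_of_lt b j (by omega)] at h
    exact h rfl
  by_contra hlt
  have hjc : j < J.size c := by
    by_contra hjc
    rw [J.vec_of_le (not_lt.mp hjc), map_zero, map_zero] at h
    exact h rfl
  refine h ?_
  -- The power `size c - j` kills `e_j`, yet it would move coordinate `i` to an index still inside
  -- block `b`.
  rw [← J.coordinate_pow_sub b (J.size c - j) (by omega), hbc, hcomm, pow_sub_vec,
    J.vec_of_le (by omega), map_zero, map_zero]

/-- The operator in the commutant that maps `e_j` of the block `c` to `e_{j + k}` of the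
block `b`, and all other blocks to zero. -/
noncomputable def blockShift (c b : Fin J.numBlocks) (k : ℕ) : Module.End ℂ V :=
  J.basis.constr ℂ fun y => if y.1 = c then J.vec b (y.2 + k) else 0

/-- The bound `hk` makes the formula valid past the end of block `c` too, where both sides vanish;
this is what lets the shift commute with `T`. -/
theorem blockShift_vec (c b : Fin J.numBlocks) {k : ℕ} (hk : J.size b ≤ J.size c + k)
    (d : Fin J.numBlocks) (j : ℕ) :
    J.blockShift c b k (J.vec d j) = if d = c then J.vec b (j + k) else 0 := by
  by_cases h : j < J.size d
  · rw [J.vec_of_lt h, blockShift, Module.Basis.constr_basis]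
  · rw [J.vec_of_le (not_lt.mp h), map_zero]
    split_ifs with hd
    · subst hd
      rw [J.vec_of_le (by omega)]
    · rfl

theorem commute_blockShift {c b : Fin J.numBlocks} {k : ℕ} (hk : J.size b ≤ J.size c + k)
    (hcb : J.eigenvalue c = J.eigenvalue b) : Commute T (J.blockShift c b k) := by
  refine J.basis.ext fun y => ?_
  rw [basis_eq_vec, Module.End.mul_apply, Module.End.mul_apply, map_vec, map_add, map_smul,
    J.blockShift_vec c b hk, J.blockShift_vec c b hk]
  split_ifs with h
  · rw [map_vec, show J.eigenvalue y.1 = J.eigenvalue b by rw [h, hcb],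
      Nat.add_right_comm (y.2 : ℕ) 1 k]
  · simp

theorem sum_coordinate_vec (x : V) :
    x = ∑ b : Fin J.numBlocks, ∑ j ∈ Finset.range (J.size b), J.coordinate b j x • J.vec b j := by
  conv_lhs => rw [← J.basis.sum_repr x, Fintype.sum_sigma]
  refine Finset.sum_congr rfl fun b _ => ?_
  rw [Finset.sum_range]
  refine Finset.sum_congr rfl fun j _ => ?_
  rw [J.coordinate_of_lt j.2, J.vec_of_lt j.2]
  rfl

/-! ### Profiles of vectors -/

/-- The profiles of vectors: a height for every block, subject to the constraints imposed by the
maps between blocks with the same eigenvalue. -/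
def IsProfile (d : Fin J.numBlocks → ℕ) : Prop :=
  (∀ b, d b ≤ J.size b) ∧
    ∀ b c, J.eigenvalue b = J.eigenvalue c → d b ≤ d c + (J.size b - J.size c)

/-- The profile of a vector: in the block `b`, the least index of a basis vector that occurs in
the image of `x` under an operator in the commutant. -/
noncomputable def profile (x : V) (b : Fin J.numBlocks) : ℕ :=
  sInf {k | J.size b ≤ k ∨ ∃ c j, J.eigenvalue c = J.eigenvalue b ∧ J.coordinate c j x ≠ 0 ∧
    j + (J.size b - J.size c) ≤ k}

theorem profile_le_iff {x : V} {b : Fin J.numBlocks} {k : ℕ} :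
    J.profile x b ≤ k ↔ J.size b ≤ k ∨ ∃ c j, J.eigenvalue c = J.eigenvalue b ∧
      J.coordinate c j x ≠ 0 ∧ j + (J.size b - J.size c) ≤ k := by
  constructor
  · intro h
    have hne : {k | J.size b ≤ k ∨ ∃ c j, J.eigenvalue c = J.eigenvalue b ∧
        J.coordinate c j x ≠ 0 ∧ j + (J.size b - J.size c) ≤ k}.Nonempty :=
      ⟨J.size b, Or.inl le_rfl⟩
    rcases Nat.sInf_mem hne with h' | ⟨c, j, hc, hj, hle⟩
    · exact Or.inl (le_trans h' h)
    · exact Or.inr ⟨c, j, hc, hj, le_trans hle h⟩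
  · exact fun h => Nat.sInf_le h

theorem isProfile_profile (x : V) : J.IsProfile (J.profile x) := by
  refine ⟨fun b => J.profile_le_iff.mpr (Or.inl le_rfl), fun b c hbc => ?_⟩
  rw [profile_le_iff]
  rcases J.profile_le_iff.mp (le_refl (J.profile x c)) with h | ⟨e, j, he, hj, hle⟩
  · left
    omega
  · exact Or.inr ⟨e, j, he.trans hbc.symm, hj, by omega⟩

/-- The span of the Jordan basis vectors whose index is at least the height of their block. -/
noncomputable def heightSpan (d : Fin J.numBlocks → ℕ) : Submodule ℂ V where
  carrier := {x | ∀ b i, i < d b → J.coordinate b i x = 0}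
  add_mem' := fun hx hy b i hi => by rw [map_add, hx b i hi, hy b i hi, add_zero]
  zero_mem' := fun b i _ => map_zero _
  smul_mem' := fun r x hx b i hi => by rw [map_smul, hx b i hi, smul_zero]

theorem mem_heightSpan {d : Fin J.numBlocks → ℕ} {x : V} :
    x ∈ J.heightSpan d ↔ ∀ b i, i < d b → J.coordinate b i x = 0 := Iff.rfl

theorem vec_mem_heightSpan_iff {d : Fin J.numBlocks → ℕ} {b : Fin J.numBlocks} {j : ℕ}
    (hj : j < J.size b) : J.vec b j ∈ J.heightSpan d ↔ d b ≤ j := by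
  rw [mem_heightSpan]
  constructor
  · intro h
    by_contra hlt
    have := h b j (not_le.mp hlt)
    rw [coordinate_vec, if_pos ⟨rfl, rfl, hj⟩] at this
    exact one_ne_zero this
  · intro h c i hi
    rw [coordinate_vec, if_neg]
    rintro ⟨rfl, rfl, -⟩
    omega

/-- The height of a block is the first index whose basis vector lies in the span. Heights beyond the
block size are indistinguishable, hence the bounds. -/
theorem heightSpan_injOn {d d' : Fin J.numBlocks → ℕ} (hd : ∀ b, d b ≤ J.size b)
    (hd' : ∀ b, d' b ≤ J.size b) (h : J.heightSpan d = J.heightSpan d') : d = d' := by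
  have key : ∀ {d d' : Fin J.numBlocks → ℕ}, (∀ b, d b ≤ J.size b) → (∀ b, d' b ≤ J.size b) →
      J.heightSpan d = J.heightSpan d' → ∀ b, d' b ≤ d b := by
    intro d d' hd hd' h b
    rcases (hd b).lt_or_eq with hlt | heq
    · exact (J.vec_mem_heightSpan_iff hlt).mp (h ▸ (J.vec_mem_heightSpan_iff hlt).mpr le_rfl)
    · exact heq ▸ hd' b
  exact funext fun b => (key hd' hd h.symm b).antisymm (key hd hd' h b)

theorem heightSpan_eq_span (d : Fin J.numBlocks → ℕ) :
    J.heightSpan d = Submodule.span ℂ (J.basis '' {y | d y.1 ≤ y.2}) := by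
  apply le_antisymm
  · intro x hx
    rw [J.basis.mem_span_image]
    intro y hy
    by_contra hlt
    rw [Finset.mem_coe, Finsupp.mem_support_iff] at hy
    have := hx y.1 y.2 (not_le.mp hlt)
    rw [J.coordinate_of_lt y.2.2] at this
    exact hy this
  · rw [Submodule.span_le]
    rintro _ ⟨y, hy, rfl⟩
    rw [basis_eq_vec]
    exact (J.vec_mem_heightSpan_iff y.2.2).mpr hy

theorem finrank_heightSpan (d : Fin J.numBlocks → ℕ) :
    Module.finrank ℂ (J.heightSpan d) = ∑ b, (J.size b - d b) := by
  classical
  have hli : LinearIndepOn ℂ id (J.basis '' {y | d y.1 ≤ y.2}) :=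
    (J.basis.linearIndependent.linearIndepOn _).id_image
  rw [heightSpan_eq_span, finrank_span_set_eq_card hli, Set.toFinset_image,
    Finset.card_image_of_injective _ J.basis.injective, Set.toFinset_ofPred]
  rw [Finset.card_filter, Fintype.sum_sigma]
  refine Finset.sum_congr rfl fun b _ => ?_
  rw [← Finset.sum_range (fun j => if d b ≤ j then 1 else 0), ← Finset.card_filter,
    ← Nat.card_Ico]
  congr 1
  ext j
  simp [and_comm]

/-- The cyclic submodule over the commutant generated by `x` depends only on its profile. -/
theorem cyclicSpan_eq_heightSpan (x : V) : cyclicSpan T x = J.heightSpan (J.profile x) := by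
  apply le_antisymm
  · intro w hw b i hi
    obtain ⟨a, ha, rfl⟩ := mem_cyclicSpan.mp hw
    rw [J.sum_coordinate_vec x]
    simp only [map_sum, map_smul, smul_eq_mul]
    refine Finset.sum_eq_zero fun c _ => Finset.sum_eq_zero fun j _ => ?_
    by_contra hne
    obtain ⟨hbc, hle⟩ := J.coordinate_commute_vec ha (right_ne_zero_of_mul hne)
    exact absurd (J.profile_le_iff.mpr
      (Or.inr ⟨c, j, hbc.symm, left_ne_zero_of_mul hne, hle⟩)) (not_le.mpr hi)
  -- Descending induction on `j` from the end of the block; `n` bounds the number of indices left.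
  · have key : ∀ b n j, J.size b ≤ j + n → J.profile x b ≤ j → J.vec b j ∈ cyclicSpan T x := by
      intro b n
      induction n with
      | zero =>
        intro j hj _
        rw [J.vec_of_le (by omega)]
        exact zero_mem _
      | succ n ih =>
        intro j hj hle
        rcases J.profile_le_iff.mp hle with h | ⟨c, j', hc, hj', hle'⟩
        · rw [J.vec_of_le h]
          exact zero_mem _
        · classical
          have hex : ∃ i, J.coordinate c i x ≠ 0 := ⟨j', hj'⟩
          -- Shifting the lowest nonzero coordinate of block `c` to index `j` of block `b` gives a
          -- multiple of `e_j` plus vectors of higher index, already covered by the induction.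
          set i₀ := Nat.find hex
          have hi₀ : J.coordinate c i₀ x ≠ 0 := Nat.find_spec hex
          have hmin : i₀ ≤ j' := Nat.find_min' hex hj'
          have hsz : i₀ < J.size c := by
            by_contra h
            rw [J.coordinate_of_le (not_lt.mp h)] at hi₀
            exact hi₀ rfl
          have hk : J.size b ≤ J.size c + (j - i₀) := by omega
          have hS : J.blockShift c b (j - i₀) x ∈ cyclicSpan T x :=
            mem_cyclicSpan.mpr ⟨_, J.commute_blockShift hk hc, rfl⟩
          have hSx : J.blockShift c b (j - i₀) x =
              ∑ i ∈ Finset.range (J.size c), J.coordinate c i x • J.vec b (i + (j - i₀)) := by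
            conv_lhs => rw [J.sum_coordinate_vec x]
            simp only [map_sum, map_smul, J.blockShift_vec c b hk]
            rw [Finset.sum_eq_single c]
            · simp
            · intro d _ hd
              simp [hd]
            · simp
          rw [hSx, ← Finset.add_sum_erase _ _ (Finset.mem_range.mpr hsz)] at hS
          have hrest : ∑ i ∈ (Finset.range (J.size c)).erase i₀,
              J.coordinate c i x • J.vec b (i + (j - i₀)) ∈ cyclicSpan T x := by
            refine sum_mem fun i hi => ?_
            rcases lt_or_gt_of_ne (Finset.ne_of_mem_erase hi) with hlt | hgt
            · rw [not_not.mp (Nat.find_min hex hlt), zero_smul]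
              exact zero_mem _
            · exact Submodule.smul_mem _ _ (ih _ (by omega) (by omega))
          have h1 := (Submodule.add_mem_iff_left _ hrest).mp hS
          rw [Submodule.smul_mem_iff _ hi₀] at h1
          rwa [show i₀ + (j - i₀) = j by omega] at h1
    rw [heightSpan_eq_span, Submodule.span_le]
    rintro _ ⟨y, hy, rfl⟩
    rw [basis_eq_vec]
    exact key y.1 (J.size y.1) y.2 (by omega) hy

/-- A vector with a given profile. -/
noncomputable def ofProfile (d : Fin J.numBlocks → ℕ) : V := ∑ b, J.vec b (d b)

theorem coordinate_ofProfile (d : Fin J.numBlocks → ℕ) (b : Fin J.numBlocks) (i : ℕ) :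
    J.coordinate b i (J.ofProfile d) = if i = d b ∧ d b < J.size b then 1 else 0 := by
  simp only [ofProfile, map_sum, coordinate_vec]
  rw [Finset.sum_eq_single b]
  · simp
  · intro c _ hc
    simp [hc.symm]
  · simp

/-- The inequalities between blocks say exactly that no block `c` pushes the height of `b` below `d
b`. A block with `d b = size b` contributes the zero vector, and its height is then given by the cap
`size b`. -/
theorem profile_ofProfile {d : Fin J.numBlocks → ℕ} (hd : J.IsProfile d) :
    J.profile (J.ofProfile d) = d := by
  funext b
  refine eq_of_forall_ge_iff fun k => ?_
  rw [profile_le_iff]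
  simp only [coordinate_ofProfile, ne_eq, ite_eq_right_iff, one_ne_zero, imp_false, not_not]
  constructor
  · rintro (h | ⟨c, j, hc, ⟨rfl, -⟩, hle⟩)
    · exact (hd.1 b).trans h
    · exact (hd.2 b c hc.symm).trans hle
  · intro h
    rcases (hd.1 b).lt_or_eq with hlt | heq
    · exact Or.inr ⟨b, d b, rfl, ⟨rfl, hlt⟩, by omega⟩
    · exact Or.inl (heq ▸ h)

/-- The orbits of the centralizer of dimension `n` correspond to the profiles of codimension
`n`. -/
theorem card_orbits [FiniteDimensional ℂ V] (n : ℕ) :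
    ENat.card {O : MulAction.orbitRel.Quotient (centralizerGroup T) V //
        algebraicDim O.orbit = (n : WithBot ℕ∞)} =
      ENat.card {d : Fin J.numBlocks → ℕ // J.IsProfile d ∧ ∑ b, (J.size b - d b) = n} := by
  have hdim : ∀ x : V, algebraicDim (MulAction.orbitRel.Quotient.orbit
      (Quotient.mk'' x : MulAction.orbitRel.Quotient (centralizerGroup T) V)) =
        (n : WithBot ℕ∞) ↔ ∑ b, (J.size b - J.profile x b) = n := fun x => by
    rw [MulAction.orbitRel.Quotient.orbit_mk, algebraicDim_orbit, J.cyclicSpan_eq_heightSpan,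
      finrank_heightSpan]
    norm_cast
  let F : {d : Fin J.numBlocks → ℕ // J.IsProfile d ∧ ∑ b, (J.size b - d b) = n} →
      {O : MulAction.orbitRel.Quotient (centralizerGroup T) V //
        algebraicDim O.orbit = (n : WithBot ℕ∞)} := fun d =>
    ⟨Quotient.mk'' (J.ofProfile d.1),
      (hdim _).mpr (by rw [J.profile_ofProfile d.2.1]; exact d.2.2)⟩
  refine (ENat.card_congr (Equiv.ofBijective F ⟨?_, ?_⟩)).symm
  · rintro ⟨d, hd, hdn⟩ ⟨d', hd', hdn'⟩ h
    have h2 : J.ofProfile d ∈ MulAction.orbit (centralizerGroup T) (J.ofProfile d') :=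
      Quotient.exact (congrArg Subtype.val h)
    rw [mem_orbit_iff_cyclicSpan_eq, J.cyclicSpan_eq_heightSpan, J.cyclicSpan_eq_heightSpan,
      J.profile_ofProfile hd, J.profile_ofProfile hd'] at h2
    exact Subtype.ext (J.heightSpan_injOn hd.1 hd'.1 h2)
  · rintro ⟨O, hO⟩
    induction O using Quotient.inductionOn' with
    | _ x =>
      refine ⟨⟨J.profile x, J.isProfile_profile x, (hdim x).mp hO⟩, Subtype.ext ?_⟩
      refine Quotient.sound ?_
      change J.ofProfile (J.profile x) ∈ MulAction.orbit (centralizerGroup T) x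
      rw [mem_orbit_iff_cyclicSpan_eq, J.cyclicSpan_eq_heightSpan, J.cyclicSpan_eq_heightSpan,
        J.profile_ofProfile (J.isProfile_profile x)]

/-! ### Counting profiles -/

theorem increment_eq (μ : ℂ) : J.increment μ = increments (J.sizeSeq μ) := rfl

theorem mem_sizes {μ : ℂ} {s : ℕ} :
    s ∈ J.sizes μ ↔ ∃ b, J.eigenvalue b = μ ∧ J.size b = s := by
  simp [sizes]

theorem exists_block (μ : ℂ) (k : Fin (J.sizes μ).card) :
    ∃ b, J.eigenvalue b = μ ∧ J.size b = J.sizeSeq μ k :=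
  J.mem_sizes.mp ((J.sizes μ).orderEmbOfFin_mem rfl k)

theorem exists_index (b : Fin J.numBlocks) :
    ∃ k, J.sizeSeq (J.eigenvalue b) k = J.size b := by
  have : J.size b ∈ Set.range (J.sizeSeq (J.eigenvalue b)) := by
    rw [sizeSeq, Finset.range_orderEmbOfFin]
    exact J.mem_sizes.mpr ⟨b, rfl, rfl⟩
  exact this

/-- The last vector of a block is an eigenvector. Thus the product over the spectrum accounts for
every block. -/
theorem hasEigenvalue (b : Fin J.numBlocks) : T.HasEigenvalue (J.eigenvalue b) := by
  have hb := J.size_pos b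
  refine Module.End.hasEigenvalue_of_hasEigenvector (x := J.vec b (J.size b - 1)) ⟨?_, ?_⟩
  · rw [Module.End.mem_eigenspace_iff, map_vec,
      J.vec_of_le (show J.size b ≤ J.size b - 1 + 1 by omega), add_zero]
  · rw [J.vec_of_lt (by omega)]
    exact J.basis.ne_zero _

/-- The types of blocks: an eigenvalue together with the index of a block size. -/
abbrev BlockType : Type := Σ μ : T.Eigenvalues, Fin (J.sizes (μ : ℂ)).card

/-- The type of a block. -/
noncomputable def blockType (b : Fin J.numBlocks) : J.BlockType :=
  ⟨⟨J.eigenvalue b, J.hasEigenvalue b⟩, (J.exists_index b).choose⟩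

theorem sizeSeq_blockType (b : Fin J.numBlocks) :
    J.sizeSeq (J.blockType b).1 (J.blockType b).2 = J.size b :=
  (J.exists_index b).choose_spec

theorem blockType_eq_iff {b : Fin J.numBlocks} {x : J.BlockType} :
    J.blockType b = x ↔ J.eigenvalue b = x.1 ∧ J.size b = J.sizeSeq x.1 x.2 := by
  constructor
  · rintro rfl
    exact ⟨rfl, (J.sizeSeq_blockType b).symm⟩
  · rintro ⟨h1, h2⟩
    rcases h : J.blockType b with ⟨μ, k⟩
    obtain ⟨ν, l⟩ := x
    have hμ : (μ : ℂ) = J.eigenvalue b := by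
      have := congrArg (fun y : J.BlockType => (y.1 : ℂ)) h
      exact this.symm
    obtain rfl : μ = ν := Subtype.ext (hμ.trans h1)
    have := J.sizeSeq_blockType b
    rw [h, h2] at this
    exact congrArg (Sigma.mk μ) ((J.sizeSeq μ).injective this)

theorem blockType_surjective : Function.Surjective J.blockType := fun x => by
  obtain ⟨b, hb⟩ := J.exists_block x.1 x.2
  exact ⟨b, J.blockType_eq_iff.mpr hb⟩

/-- The coheights of the profile given by a choice of increments. -/
noncomputable def coheight (a : J.BlockType → ℕ) (x : J.BlockType) : ℕ :=
  ∑ l ∈ Finset.Iic x.2, a ⟨x.1, l⟩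

theorem coheight_le {a : J.BlockType → ℕ} (ha : ∀ x, a x ≤ J.increment x.1 x.2)
    (b : Fin J.numBlocks) : J.coheight a (J.blockType b) ≤ J.size b := by
  rw [← J.sizeSeq_blockType b]
  exact sum_Iic_le (J.sizeSeq _).monotone (fun k => ha ⟨_, k⟩) _

theorem isProfile_of_increments {a : J.BlockType → ℕ} (ha : ∀ x, a x ≤ J.increment x.1 x.2) :
    J.IsProfile fun b => J.size b - J.coheight a (J.blockType b) := by
  refine ⟨fun b => Nat.sub_le _ _, fun b c hbc => ?_⟩
  have hb := J.coheight_le ha b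
  have hc := J.coheight_le ha c
  have hsb := J.sizeSeq_blockType b
  have hsc := J.sizeSeq_blockType c
  have hμν : (J.blockType b).1 = (J.blockType c).1 := Subtype.ext hbc
  beta_reduce
  -- The types are made variables so that the equality of eigenvalues can be substituted in the
  -- dependent index.
  generalize J.blockType b = x at *
  generalize J.blockType c = y at *
  obtain ⟨μ, k⟩ := x
  obtain ⟨ν, l⟩ := y
  dsimp only at hμν
  subst hμν
  rw [← hsb] at hb
  rw [← hsc] at hc
  rw [← hsb, ← hsc]
  -- If `b` is the smaller block, the inequality says that coheights grow at most like sizes; if it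
  -- is the larger, that they are nondecreasing.
  rcases le_total k l with hkl | hkl
  · have h1 := (J.sizeSeq μ).monotone hkl
    have h2 := sum_Iic_le_add (J.sizeSeq μ).monotone (fun k => ha ⟨μ, k⟩) hkl
    simp only [coheight] at hb hc ⊢
    omega
  · have h1 := (J.sizeSeq μ).monotone hkl
    have h2 : J.coheight a ⟨μ, l⟩ ≤ J.coheight a ⟨μ, k⟩ :=
      Finset.sum_le_sum_of_subset (Finset.Iic_subset_Iic.mpr hkl)
    omega

/-- Double counting: the increment at index `l` enters the coheight of each block of the same
eigenvalue with index `k ≥ l`, and the tail sum counts these blocks. -/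
theorem sum_coheight [FiniteDimensional ℂ V] (a : J.BlockType → ℕ) :
    ∑ b, J.coheight a (J.blockType b) = ∑ x : J.BlockType, a x * J.tailSum x.1 x.2 := by
  classical
  have hcard : ∀ x : J.BlockType, (Finset.univ.filter fun b => J.blockType b = x).card =
      J.multiplicity x.1 (J.sizeSeq x.1 x.2) := fun x => by
    rw [multiplicity, Nat.card_eq_fintype_card, Fintype.card_subtype]
    simp only [blockType_eq_iff]
  rw [← Finset.sum_fiberwise Finset.univ J.blockType]
  have : ∀ x : J.BlockType, ∑ b with J.blockType b = x, J.coheight a (J.blockType b) =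
      J.multiplicity x.1 (J.sizeSeq x.1 x.2) * J.coheight a x := fun x => by
    rw [← hcard, ← smul_eq_mul, ← Finset.sum_const]
    exact Finset.sum_congr rfl fun b hb => by rw [(Finset.mem_filter.mp hb).2]
  rw [Finset.sum_congr rfl fun x _ => this x]
  simp only [coheight, tailSum, Fintype.sum_sigma, Finset.mul_sum]
  refine Finset.sum_congr rfl fun μ _ => ?_
  rw [Finset.sum_comm' (t' := Finset.univ) (s' := fun l => Finset.Ici l) (by simp)]
  exact Finset.sum_congr rfl fun l _ => Finset.sum_congr rfl fun k _ => mul_comm _ _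

/-- Every profile arises from a choice of increments. -/
theorem exists_increments {d : Fin J.numBlocks → ℕ} (hd : J.IsProfile d) :
    ∃ a : J.BlockType → ℕ, (∀ x, a x ≤ J.increment x.1 x.2) ∧
      ∀ b, J.size b - J.coheight a (J.blockType b) = d b := by
  -- One representative block per type; its coheight `h` has the required increments.
  choose β hβ using J.blockType_surjective
  have hβ' := fun x => J.blockType_eq_iff.mp (hβ x)
  let h : J.BlockType → ℕ := fun x => J.size (β x) - d (β x)
  have hle : ∀ μ (k l : Fin (J.sizes (μ : T.Eigenvalues)).card), k ≤ l →
      h ⟨μ, k⟩ ≤ h ⟨μ, l⟩ ∧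
        h ⟨μ, l⟩ ≤ h ⟨μ, k⟩ + (J.sizeSeq μ l - J.sizeSeq μ k) := by
    intro μ k l hkl
    have h1 := (J.sizeSeq μ).monotone hkl
    have h2 := hd.2 (β ⟨μ, k⟩) (β ⟨μ, l⟩) ((hβ' ⟨μ, k⟩).1.trans (hβ' ⟨μ, l⟩).1.symm)
    have h3 := hd.2 (β ⟨μ, l⟩) (β ⟨μ, k⟩) ((hβ' ⟨μ, l⟩).1.trans (hβ' ⟨μ, k⟩).1.symm)
    have h4 := hd.1 (β ⟨μ, k⟩)
    have h5 := hd.1 (β ⟨μ, l⟩)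
    simp only [h]
    simp only [(hβ' _).2] at h2 h3 h4 h5 ⊢
    omega
  refine ⟨fun x => increments (fun k => h ⟨x.1, k⟩) x.2, fun x => ?_, fun b => ?_⟩
  · rw [increment_eq]
    refine increments_le (fun k => ?_) (fun k l hkl => (hle x.1 k l hkl).2) x.2
    rw [← (hβ' ⟨x.1, k⟩).2]
    exact Nat.sub_le _ _
  · have h1 : J.coheight (fun x => increments (fun k => h ⟨x.1, k⟩) x.2) (J.blockType b) =
        h (J.blockType b) :=
      sum_Iic_increments (fun k l hkl => (hle _ k l hkl).1) _
    obtain ⟨he, hs⟩ := hβ' (J.blockType b)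
    rw [J.sizeSeq_blockType] at hs
    -- Two blocks of equal size and eigenvalue bound each other's heights with no slack, so the
    -- choice of representative is immaterial.
    have h2 := hd.2 b (β (J.blockType b)) he.symm
    have h3 := hd.2 (β (J.blockType b)) b he
    have h4 := hd.1 b
    rw [h1]
    simp only [h]
    omega

theorem card_profiles [FiniteDimensional ℂ V] (n : ℕ) :
    ENat.card {d : Fin J.numBlocks → ℕ // J.IsProfile d ∧ ∑ b, (J.size b - d b) = n} =
      ENat.card {a : J.BlockType → ℕ // (∀ x, a x ≤ J.increment x.1 x.2) ∧
        ∑ x, a x * J.tailSum x.1 x.2 = n} := by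
  have hsum : ∀ a : J.BlockType → ℕ, (∀ x, a x ≤ J.increment x.1 x.2) →
      ∑ b, (J.size b - (J.size b - J.coheight a (J.blockType b))) =
        ∑ x, a x * J.tailSum x.1 x.2 := fun a ha => by
    rw [← sum_coheight]
    exact Finset.sum_congr rfl fun b _ => Nat.sub_sub_self (J.coheight_le ha b)
  let F : {a : J.BlockType → ℕ // (∀ x, a x ≤ J.increment x.1 x.2) ∧
        ∑ x, a x * J.tailSum x.1 x.2 = n} →
      {d : Fin J.numBlocks → ℕ // J.IsProfile d ∧ ∑ b, (J.size b - d b) = n} := fun a =>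
    ⟨fun b => J.size b - J.coheight a.1 (J.blockType b), J.isProfile_of_increments a.2.1,
      (hsum a.1 a.2.1).trans a.2.2⟩
  refine (ENat.card_congr (Equiv.ofBijective F ⟨?_, ?_⟩)).symm
  · rintro ⟨a, ha, hna⟩ ⟨a', ha', hna'⟩ h
    have hco : J.coheight a = J.coheight a' := by
      funext x
      obtain ⟨b, rfl⟩ := J.blockType_surjective x
      have h1 : J.size b - J.coheight a (J.blockType b) =
        J.size b - J.coheight a' (J.blockType b) := congrFun (congrArg Subtype.val h) b
      have h2 := J.coheight_le ha b
      have h3 := J.coheight_le ha' b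
      omega
    refine Subtype.ext (funext fun ⟨μ, k⟩ => ?_)
    have key : ∀ a : J.BlockType → ℕ, increments (fun k => J.coheight a ⟨μ, k⟩) k = a ⟨μ, k⟩ :=
      fun a => congrFun (increments_sum_Iic fun k => a ⟨μ, k⟩) k
    exact (key a).symm.trans (hco ▸ key a')
  · rintro ⟨d, hd, hdn⟩
    obtain ⟨a, ha, had⟩ := J.exists_increments hd
    refine ⟨⟨a, ha, ?_⟩, Subtype.ext (funext had)⟩
    rw [← hsum a ha, ← hdn]
    simp only [had]

/-- Expanding the product of sums, each admissible choice of increments contributes one monomial.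
Equality in `ℕ∞` with a natural number also carries the finiteness of the count. -/
theorem coeff_prod_genPoly [FiniteDimensional ℂ V] (n : ℕ) :
    (((∏ μ : T.Eigenvalues, J.genPoly (μ : ℂ)).coeff n : ℕ) : ℕ∞) =
      ENat.card {a : J.BlockType → ℕ // (∀ x, a x ≤ J.increment x.1 x.2) ∧
        ∑ x, a x * J.tailSum x.1 x.2 = n} := by
  classical
  have hprod : (∏ μ : T.Eigenvalues, J.genPoly (μ : ℂ)) =
      ∑ a ∈ Fintype.piFinset fun x : J.BlockType => Finset.range (J.increment x.1 x.2 + 1),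
        (X : ℕ[X]) ^ ∑ x, a x * J.tailSum x.1 x.2 := by
    simp only [genPoly]
    rw [← Fintype.prod_sigma' fun (μ : T.Eigenvalues) (k : Fin (J.sizes (μ : ℂ)).card) =>
      ∑ i ∈ Finset.range (J.increment μ k + 1), (X : ℕ[X]) ^ (i * J.tailSum μ k),
      Finset.prod_univ_sum]
    exact Finset.sum_congr rfl fun a _ => Finset.prod_pow_eq_pow_sum _ _ _
  rw [hprod, finsetSum_coeff]
  simp only [coeff_X_pow]
  rw [← Finset.card_filter, ← Fintype.card_coe, ← ENat.card_eq_coe_fintype_card]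
  refine ENat.card_congr (Equiv.subtypeEquivRight fun a => ?_)
  simp only [Finset.mem_filter, Fintype.mem_piFinset, Finset.mem_range, Nat.lt_succ_iff,
    eq_comm (a := n)]

end JordanDecomposition

end CentralizerOrbits

theorem mainTheorem6 {V : Type*} [AddCommGroup V] [Module ℂ V] [FiniteDimensional ℂ V]
    (T : Module.End ℂ V) (J : CentralizerOrbits.JordanDecomposition T) (n : ℕ) :
    ENat.card {O : MulAction.orbitRel.Quotient (CentralizerOrbits.centralizerGroup T) V //
        CentralizerOrbits.algebraicDim O.orbit = (n : WithBot ℕ∞)} =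
      (((∏ μ : T.Eigenvalues, J.genPoly (μ : ℂ)).coeff n : ℕ) : ℕ∞) := by
  rw [J.card_orbits, J.card_profiles, J.coeff_prod_genPoly]
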